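/- **Setting.** A list of $\ell$ distinct items is shared by $p$ processes; process $i$ has a finite request sequence $\sigma_i$ of items of the list. A *merge* of $\sigma_1,\dots,\sigma_p$ is an interleaving of their requests that respects the order of each $\sigma_i$. Locations in the list are numbered $1,\dots,\ell$ from the front. **DMTF at the item access level.** A *schedule* is a finite sequence of processes; in each of its steps the named process makes one item access (a process that has completed all its requests does nothing). Each process serves its requests in order, one search at a time, beginning with its first item access; a search for $a$ inspects the locations $1,2,3,\dots$ of the current list in turn. When a search reaches $a$, in location $k$ say, the item $a$ is moved to the front and the request is completed. Every other process that has at that moment begun and not completed a search for $a$ (and for which $a$ has not already been moved to the front by another process during this search) is assumed to find $a$ in the same location: it completes its request when it has made $k$ item accesses in this search, and it moves nothing. Say that $M_1$ is served under the schedule if all requests of all processes are completed and $M_1$ is the sequence of requests in order of completion, i.e. in the order in which processes move the requested item to the front or discover that it has been moved. For such a schedule, $\mathrm{DMTF}(M_1)$ denotes the total number of item accesses in the execution. **OPT.** For a request sequence $M_2$, $\mathrm{OPT}(M_2)$ is the minimum cost of serving $M_2$ sequentially offline, from the same initial list as DMTF: accessing the item in location $k$ costs $k$, after which it may be moved free of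 charge to any location closer to the front; exchanging two adjacent items at any time costs $1$. **Theorem.** For all $p$ and $\ell$ there is a constant $K$, depending only on $p$ and $\ell$, such that for every initial list of $\ell$ items, all request sequences $\sigma_1,\dots,\sigma_p$, any two merges $M_1$, $M_2$ of them, and every schedule under which DMTF serves $M_1$, $$\mathrm{DMTF}(M_1) \le (4p^2-2p)\,\mathrm{OPT}(M_2) + K .$$ -/

import Mathlib

namespace ListAccess

variable {α : Type*} {p : ℕ}

/-- `M` is a merge of the request sequences `σ 0, …, σ (p - 1)`: every entry of `M` is a request
tagged with the process that issues it, and the requests of process `i`, in the order in which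
they occur in `M`, form the sequence `σ i`. -/
def IsMerge (σ : Fin p → List α) (M : List (Fin p × α)) : Prop :=
  ∀ i, (M.filter fun r => decide (r.1 = i)).map Prod.snd = σ i

/-! ### Sequential offline list accessing -/

/-- `OfflineCost L I c`: starting from the list `L`, the request sequence `I` can be served
sequentially with total cost `c`. Accessing the item in location `k` costs `k` (locations are
counted from `1`), after which the item may be moved, free of charge, to any location closer to
the front. At any time two adjacent items may be exchanged at cost `1`. -/
inductive OfflineCost : List α → List α → ℕ → Prop
  | done (L : List α) : OfflineCost L [] 0
  | exchange (u v : List α) (x y : α) (I : List α) (c : ℕ) :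
      OfflineCost (u ++ y :: x :: v) I c → OfflineCost (u ++ x :: y :: v) I (c + 1)
  | access (u v w : List α) (a : α) (I : List α) (c : ℕ) :
      OfflineCost (u ++ a :: (v ++ w)) I c →
        OfflineCost (u ++ v ++ a :: w) (a :: I) ((u ++ v).length + 1 + c)

/-- Some offline service exists as soon as all requested items are in the list. -/
theorem exists_offlineCost (L I : List α) (h : ∀ a ∈ I, a ∈ L) : ∃ c, OfflineCost L I c := by
  induction I with
  | nil => exact ⟨0, .done L⟩
  | cons a I ih =>
    obtain ⟨c, hc⟩ := ih fun b hb => h b (List.mem_cons_of_mem _ hb)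
    obtain ⟨u, w, rfl⟩ := List.append_of_mem (h a List.mem_cons_self)
    have := OfflineCost.access u [] w a I c (by simpa using hc)
    exact ⟨_, by simpa using this⟩

/-- The cost of an optimal sequential offline algorithm on the request sequence `I`, starting
from the list `L`. -/
noncomputable def opt (L I : List α) : ℕ := sInf {c | OfflineCost L I c}

/-! ### Distributed Move-to-Front with interleaving at the item access level -/

/-- The local state of a process. -/
structure Searcher (α : Type*) where
  /-- the requests not yet completed; the head is the current one -/
  pending : List α
  /-- the number of item accesses made so far in the search for the current request
  (`0` if this search has not begun) -/
  inspected : ℕ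
  /-- `some k` if, since the beginning of the current search, another process has found the
  requested item in location `k` and has moved it to the front -/
  foundAt : Option ℕ

/-- A configuration of the system. -/
structure Config (p : ℕ) (α : Type*) where
  /-- the shared list -/
  list : List α
  /-- the processes -/
  procs : Fin p → Searcher α
  /-- the completed requests, in the order in which they were completed -/
  served : List (Fin p × α)
  /-- the total number of item accesses -/
  cost : ℕ

/-- The initial configuration. -/
def Config.init (L : List α) (σ : Fin p → List α) : Config p α where
  list := L
  procs i := ⟨σ i, 0, none⟩
  served := []
  cost := 0

variable [DecidableEq α]

/-- A process that is in the middle of a search for `a` when another process finds `a` in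
location `k` and moves it to the front will find `a` in that same location `k`. -/
def Searcher.notify (a : α) (k : ℕ) (P : Searcher α) : Searcher α :=
  if P.pending.head? = some a ∧ 0 < P.inspected ∧ P.foundAt = none then
    { P with foundAt := some k }
  else P

/-- One step of process `i`, which is one item access (or nothing, if the process has completed
all its requests). A search inspects the locations `1, 2, 3, …` of the shared list in turn.

* If the requested item has not been moved by another process during this search, the next
  location of the current list is inspected. If it holds the item, the item is moved to the
  front, the other processes that are searching for this item are notified of the location in
  which it was found, and the request is completed.
* If another process has in the meantime found the item in location `k` and moved it to the
  front, the search goes on to location `k`, where it is completed; nothing is moved. -/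
def step (C : Config p α) (i : Fin p) : Config p α :=
  match (C.procs i).pending with
  | [] => C
  | a :: rest =>
    let n := (C.procs i).inspected
    let goOn : Config p α :=
      { C with
        procs := Function.update C.procs i { C.procs i with inspected := n + 1 }
        cost := C.cost + 1 }
    match (C.procs i).foundAt with
    | none =>
      if C.list[n]? = some a then
        { list := a :: C.list.erase a
          procs := Function.update (fun j => (C.procs j).notify a (n + 1)) i ⟨rest, 0, none⟩
          served := C.served ++ [(i, a)]
          cost := C.cost + 1 }
      else goOn
    | some k =>
      if n + 1 = k then
        { C with
          procs := Function.update C.procs i ⟨rest, 0, none⟩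
          served := C.served ++ [(i, a)]
          cost := C.cost + 1 }
      else goOn

/-- The final configuration of the execution on the request sequences `σ`, starting from the
list `L`, in which the processes take steps in the order given by the schedule `s`. -/
def dmtf (L : List α) (σ : Fin p → List α) (s : List (Fin p)) : Config p α :=
  s.foldl step (Config.init L σ)

/-- Under the schedule `s`, all requests are completed, in the order given by `M`: this is the
order in which the processes move the requested item to the front or discover that another
process has moved it. -/
def DMTFServes (L : List α) (σ : Fin p → List α) (s : List (Fin p)) (M : List (Fin p × α)) :
    Prop :=
  (∀ i, ((dmtf L σ s).procs i).pending = []) ∧ (dmtf L σ s).served = M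

/-- The cost of distributed Move-to-Front under the schedule `s`: its total number of item
accesses. -/
def dmtfCost (L : List α) (σ : Fin p → List α) (s : List (Fin p)) : ℕ :=
  (dmtf L σ s).cost

end ListAccess

/-! The shared execution is compared with separate runs of Move-to-Front on each `σ i`. Give every
process a fictitious private list, in which an item moves to the front when it is found for that
process, by itself or by another process during its search.

Let `k` find `x`, with `d` items in front of `x` in the private list of `k`, and let `y`, last moved
by `j`, be in front of `x` in the shared list. If `j = k`, then `y` is among those `d` items. If `j
≠ k`, the visit to `y` is charged to the next request of `j` for `y`, as long as `k` has placed
fewer charges there than the location of `y` in the private list of `j`. Once this quota is used up,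
the charging items are distinct and all in front of `x` in the private list of `k`, so that location
is at most `d`; hence each `j` has at most `d` such `y`. The uncharged items thus number at most `p
* d`, and a request pays at most `p - 1` times its private cost for charges: the factor is `p + (p -
1)` (`Charging.accounting`, `dmtfCost_le`). Charges never paid are bounded in terms of `p` and `ℓ`,
which gives the constant.

Each `σ i` is a subsequence of `M₂`, and the inversion potential survives skipped requests, so its
private cost is at most twice the optimum for `M₂` (`OfflineCost.mtfCost_le`). Summing over the
processes gives `2 * p * (2 * p - 1)`. -/

namespace ListAccess

variable {α : Type*} {p : ℕ}

/-- `L` lists every element of `α` exactly once. -/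
def IsListing (L : List α) : Prop := L.Nodup ∧ ∀ a, a ∈ L

theorem IsListing.perm {L L' : List α} (h : IsListing L) (hp : L.Perm L') : IsListing L' :=
  ⟨hp.nodup_iff.1 h.1, fun a => hp.mem_iff.1 (h.2 a)⟩

section Charges

variable [Fintype α]

/-- The number of charges that have not been paid yet. -/
def chargeSum (G : Fin p → Fin p → α → Finset α) : ℕ := ∑ k, ∑ j, ∑ y, (G k j y).card

theorem chargeSum_le (G : Fin p → Fin p → α → Finset α) :
    chargeSum G ≤ p * (p * (Fintype.card α * Fintype.card α)) := by
  have : chargeSum G ≤ ∑ _k : Fin p, ∑ _j : Fin p, ∑ _y : α, Fintype.card α :=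
    Finset.sum_le_sum fun k _ => Finset.sum_le_sum fun j _ => Finset.sum_le_sum fun y _ =>
      Finset.card_le_univ _
  simpa using this

end Charges

variable [DecidableEq α]

/-! ### Moving an item to the front of a list -/

/-- The list `L` after `a` has been moved to the front. -/
def moveToFront (a : α) (L : List α) : List α := a :: L.erase a

/-- The cost of sequential Move-to-Front on the request sequence `I`, starting from `L`. -/
def mtfCost : List α → List α → ℕ
  | _, [] => 0
  | L, a :: I => L.idxOf a + 1 + mtfCost (moveToFront a L) I

theorem IsListing.moveToFront {L : List α} (h : IsListing L) (a : α) :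
    IsListing (moveToFront a L) := by
  refine ⟨List.nodup_cons.2 ⟨h.1.not_mem_erase, h.1.erase a⟩, fun b => ?_⟩
  rcases eq_or_ne b a with rfl | hb
  · exact List.mem_cons_self
  · exact List.mem_cons_of_mem _ ((List.mem_erase_of_ne hb).2 (h.2 b))

theorem IsListing.idxOf_inj {L : List α} (h : IsListing L) {a b : α}
    (hab : L.idxOf a = L.idxOf b) : a = b :=
  (List.idxOf_inj (h.2 a)).1 hab

theorem idxOf_moveToFront_self (a : α) (L : List α) : (moveToFront a L).idxOf a = 0 := by
  simp [moveToFront]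

theorem idxOf_moveToFront_of_ne {a b : α} (hb : b ≠ a) (L : List α) (ha : a ∈ L) :
    (moveToFront a L).idxOf b =
      if L.idxOf b < L.idxOf a then L.idxOf b + 1 else L.idxOf b := by
  rw [moveToFront, List.idxOf_cons_ne _ hb.symm]
  induction L with
  | nil => simp at ha
  | cons c L ih =>
    rcases eq_or_ne c a with rfl | hca
    · simp [List.idxOf_cons_ne _ hb.symm]
    · rw [List.erase_cons_tail (by simpa using hca)]
      have ha' : a ∈ L := by simpa [hca.symm] using ha
      rcases eq_or_ne c b with rfl | hcb
      · simp [List.idxOf_cons_ne _ hca]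
      · rw [List.idxOf_cons_ne _ hcb, List.idxOf_cons_ne _ hcb, List.idxOf_cons_ne _ hca, ih ha']
        split_ifs <;> omega

theorem idxOf_moveToFront_self_lt {L : List α} (hL : IsListing L) {x z : α} (hz : z ≠ x) :
    (moveToFront x L).idxOf x < (moveToFront x L).idxOf z := by
  rw [idxOf_moveToFront_self]
  refine Nat.pos_of_ne_zero fun h => hz ((hL.moveToFront x).idxOf_inj ?_)
  rw [h, idxOf_moveToFront_self]

theorem idxOf_moveToFront_lt {L : List α} (hL : IsListing L) {x y z : α} (hz : z ≠ x)
    (h : L.idxOf y < L.idxOf z) : (moveToFront x L).idxOf y < (moveToFront x L).idxOf z := by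
  rcases eq_or_ne y x with rfl | hy
  · exact idxOf_moveToFront_self_lt hL hz
  · have hne : L.idxOf z ≠ L.idxOf x := fun e => hz (hL.idxOf_inj e)
    rw [idxOf_moveToFront_of_ne hz _ (hL.2 _), idxOf_moveToFront_of_ne hy _ (hL.2 _)]
    split_ifs <;> omega

/-- Only `x` can overtake other items, so an order whose leading item is not `x` was there before
the move. -/
theorem lt_of_idxOf_moveToFront_lt {L : List α} (hL : IsListing L) {x y z : α} (hy : y ≠ x)
    (h : (moveToFront x L).idxOf y < (moveToFront x L).idxOf z) :
    z ≠ x ∧ L.idxOf y < L.idxOf z := by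
  have hz : z ≠ x := by
    rintro rfl
    rw [idxOf_moveToFront_self] at h
    exact Nat.not_lt_zero _ h
  refine ⟨hz, ?_⟩
  have hne : L.idxOf y ≠ L.idxOf z := fun e => by
    rw [hL.idxOf_inj e] at h
    exact lt_irrefl _ h
  rw [idxOf_moveToFront_of_ne hz _ (hL.2 _), idxOf_moveToFront_of_ne hy _ (hL.2 _)] at h
  split_ifs at h <;> omega

theorem le_idxOf_moveToFront {L : List α} (hL : IsListing L) {x y : α} (hy : y ≠ x) :
    L.idxOf y ≤ (moveToFront x L).idxOf y := by
  rw [idxOf_moveToFront_of_ne hy _ (hL.2 _)]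
  split_ifs <;> omega

theorem idxOf_lt_idxOf_of_forward {u v w : List α} {a : α} (h : (u ++ v ++ a :: w).Nodup)
    {b c : α} (hb : b ∈ u ++ v ++ a :: w) (hc : c ∈ u ++ v ++ a :: w) (hba : b ≠ a)
    (hlt : (u ++ a :: (v ++ w)).idxOf b < (u ++ a :: (v ++ w)).idxOf c) :
    (u ++ v ++ a :: w).idxOf b < (u ++ v ++ a :: w).idxOf c := by
  have h1 : ∀ x ∈ v, x ∉ u := by grind
  have h2 : ∀ x ∈ w, x ∉ u ∧ x ∉ v ∧ x ≠ a := by grind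
  have h3 : a ∉ u ∧ a ∉ v := by grind
  simp only [List.idxOf_append, List.idxOf_cons, List.mem_append, List.mem_cons] at *
  have hu : ∀ x ∈ u, u.idxOf x < u.length := fun x hx => List.idxOf_lt_length_iff.2 hx
  have hv : ∀ x ∈ v, v.idxOf x < v.length := fun x hx => List.idxOf_lt_length_iff.2 hx
  grind

theorem idxOf_lt_idxOf_of_swap {u v : List α} {x y : α} (h : (u ++ x :: y :: v).Nodup)
    {b c : α} (hbc : ¬(b = y ∧ c = x))
    (hlt : (u ++ y :: x :: v).idxOf b < (u ++ y :: x :: v).idxOf c) :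
    (u ++ x :: y :: v).idxOf b < (u ++ x :: y :: v).idxOf c := by
  have h1 : ∀ z ∈ v, z ∉ u ∧ z ≠ x ∧ z ≠ y := by grind
  have h2 : x ∉ u ∧ y ∉ u ∧ x ≠ y := by grind
  simp only [List.idxOf_append, List.idxOf_cons] at *
  have hu : ∀ z ∈ u, u.idxOf z < u.length := fun z hz => List.idxOf_lt_length_iff.2 hz
  grind

theorem idxOf_append_cons_self {u w : List α} {a : α} (h : (u ++ a :: w).Nodup) :
    (u ++ a :: w).idxOf a = u.length := by
  have : a ∉ u := by grind
  simp [List.idxOf_append, this]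

/-! ### Charging the items in front of a requested item -/

/-- The invariant relating the shared list `L` to the private Move-to-Front lists `Ls i` of the
processes. The process `owner y` is the last one to have moved `y` in `L`, and `G k j y` consists
of items requested by `k` since the last request of `j` for `y`, each of which has been
charged, when it was found behind `y` in `L`, to the next request of `j` for `y`. -/
structure Charging (L : List α) (owner : α → Fin p) (Ls : Fin p → List α)
    (G : Fin p → Fin p → α → Finset α) : Prop where
  listing : IsListing L
  listings : ∀ i, IsListing (Ls i)
  owner_lt : ∀ y z, L.idxOf y < L.idxOf z → (Ls (owner y)).idxOf y < (Ls (owner y)).idxOf z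
  self_eq_empty : ∀ k y, G k k y = ∅
  card_le : ∀ k j y, (G k j y).card ≤ (Ls j).idxOf y + 1
  charged_lt : ∀ k y z, L.idxOf y < L.idxOf z → ∀ w ∈ G k (owner y) y,
    (Ls k).idxOf w < (Ls k).idxOf z

theorem charging_init (L : List α) (hL : IsListing L) (i : Fin p) :
    Charging L (fun _ => i) (fun _ => L) fun _ _ _ => ∅ where
  listing := hL
  listings _ := hL
  owner_lt _ _ h := h
  self_eq_empty _ _ := rfl
  card_le _ _ _ := by simp
  charged_lt _ _ _ _ _ hw := by simp at hw

/-- The condition under which the request of process `k` for `x` is charged to the item `y`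
in front of `x`, last moved by process `j`. -/
def IsCharged (L : List α) (owner : α → Fin p) (Ls : Fin p → List α)
    (G : Fin p → Fin p → α → Finset α) (x : α) (k j : Fin p) (y : α) : Prop :=
  k ≠ j ∧ owner y = j ∧ L.idxOf y < L.idxOf x ∧ (G k j y).card < (Ls j).idxOf y + 1

open Classical in
/-- The charges after the processes in `S` have had `x` moved to the front. -/
noncomputable def chargeNext (L : List α) (owner : α → Fin p) (Ls : Fin p → List α)
    (G : Fin p → Fin p → α → Finset α) (x : α) (S : Finset (Fin p)) (k j : Fin p) (y : α) :
    Finset α :=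
  if y = x then (if j ∈ S then ∅ else G k j y)
  else if k ∈ S ∧ IsCharged L owner Ls G x k j y then insert x (G k j y) else G k j y

variable {L : List α} {owner : α → Fin p} {Ls : Fin p → List α}
  {G : Fin p → Fin p → α → Finset α}

/-- An item overtakes others in a private list only when it also moves to the front of the shared
list, so orders shared by both lists persist. Since `i ∈ S`, the charges to the new owner's next
request for `x` start afresh. -/
theorem Charging.next (h : Charging L owner Ls G) (x : α) {S : Finset (Fin p)} {i : Fin p}
    (hi : i ∈ S) :
    Charging (moveToFront x L) (Function.update owner x i)
      (fun j => if j ∈ S then moveToFront x (Ls j) else Ls j)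
      (chargeNext L owner Ls G x S) where
  listing := h.listing.moveToFront x
  listings j := by
    split_ifs
    exacts [(h.listings j).moveToFront x, h.listings j]
  owner_lt y z hyz := by
    rcases eq_or_ne y x with rfl | hy
    · have hz : z ≠ y := by rintro rfl; exact lt_irrefl _ hyz
      simpa [hi] using idxOf_moveToFront_self_lt (h.listings i) hz
    · obtain ⟨hz, hlt⟩ := lt_of_idxOf_moveToFront_lt h.listing hy hyz
      rw [Function.update_of_ne hy]
      have := h.owner_lt y z hlt
      split_ifs
      exacts [idxOf_moveToFront_lt (h.listings _) hz this, this]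
  self_eq_empty k y := by
    have := h.self_eq_empty k y
    simp [chargeNext, IsCharged, this]
  card_le k j y := by
    have hle := h.card_le k j y
    unfold chargeNext
    by_cases hy : y = x
    · rw [if_pos hy]
      split_ifs
      · simp
      · exact hle
    · rw [if_neg hy]
      have hmono : (Ls j).idxOf y ≤ (if j ∈ S then moveToFront x (Ls j) else Ls j).idxOf y := by
        split_ifs
        exacts [le_idxOf_moveToFront (h.listings j) hy, le_rfl]
      refine le_trans ?_ (Nat.add_le_add_right hmono 1)
      split_ifs with hc
      · exact (Finset.card_insert_le _ _).trans hc.2.2.2.2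
      · exact hle
  charged_lt k y z hyz w hw := by
    rcases eq_or_ne y x with rfl | hy
    · simp [chargeNext, hi] at hw
    · obtain ⟨hz, hlt⟩ := lt_of_idxOf_moveToFront_lt h.listing hy hyz
      rw [Function.update_of_ne hy] at hw
      have hold : w ∈ G k (owner y) y →
          (if k ∈ S then moveToFront x (Ls k) else Ls k).idxOf w <
            (if k ∈ S then moveToFront x (Ls k) else Ls k).idxOf z := fun hw => by
        have := h.charged_lt k y z hlt w hw
        split_ifs
        exacts [idxOf_moveToFront_lt (h.listings _) hz this, this]
      unfold chargeNext at hw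
      rw [if_neg hy] at hw
      split_ifs at hw with hc
      · rcases Finset.mem_insert.1 hw with rfl | hw
        · simpa [hc.1] using idxOf_moveToFront_self_lt (h.listings k) hz
        · exact hold hw
      · exact hold hw

variable [Fintype α]

theorem IsListing.card_filter_idxOf_lt {L : List α} (h : IsListing L) (a : α) :
    (Finset.univ.filter fun b => L.idxOf b < L.idxOf a).card = L.idxOf a := by
  have hlt : L.idxOf a < L.length := List.idxOf_lt_length_iff.2 (h.2 a)
  conv_rhs => rw [← Finset.card_range (L.idxOf a)]
  refine Finset.card_bij (fun b _ => L.idxOf b) (by simp) (fun b _ c _ e => h.idxOf_inj e) ?_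
  intro n hn
  have hn' : n < L.length := (Finset.mem_range.1 hn).trans hlt
  refine ⟨L[n], ?_, h.1.idxOf_getElem n hn'⟩
  simpa [h.1.idxOf_getElem n hn'] using hn

open Classical in
/-- Among the items in front of `x` last moved by `j`, all but as many as there are items in front
of `x` in the private list of `k` are charged. -/
theorem Charging.card_owned_le (h : Charging L owner Ls G) (x : α) {k j : Fin p} (hkj : k ≠ j) :
    (Finset.univ.filter fun y => owner y = j ∧ L.idxOf y < L.idxOf x).card ≤
      (Ls k).idxOf x + (Finset.univ.filter fun y => IsCharged L owner Ls G x k j y).card := by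
  -- `U` collects the items whose quota is used up. Their locations in the private list of `j` are
  -- distinct and bounded by the number of charging items, all in front of `x` in the list of `k`.
  set U := Finset.univ.filter fun y =>
    (owner y = j ∧ L.idxOf y < L.idxOf x) ∧ (Ls j).idxOf y + 1 ≤ (G k j y).card with hU
  have hU' : U.card ≤ (Ls k).idxOf x := by
    have hmaps : ∀ y ∈ U, (Ls j).idxOf y ∈ Finset.range ((Ls k).idxOf x) := by
      intro y hy
      obtain ⟨⟨rfl, hlt⟩, hc⟩ := (Finset.mem_filter.1 hy).2
      rw [Finset.mem_range]
      have : G k (owner y) y ⊆ Finset.univ.filter fun w => (Ls k).idxOf w < (Ls k).idxOf x :=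
        fun w hw => by simpa using h.charged_lt k y x hlt w hw
      have := Finset.card_le_card this
      rw [(h.listings k).card_filter_idxOf_lt] at this
      omega
    have := Finset.card_le_card_of_injOn _ hmaps fun a _ b _ e => (h.listings j).idxOf_inj e
    simpa using this
  refine le_trans (Finset.card_le_card (t := U ∪ _) ?_)
    ((Finset.card_union_le U (Finset.univ.filter fun y => IsCharged L owner Ls G x k j y)).trans
      (Nat.add_le_add_right hU' _))
  intro y hy
  simp only [hU, Finset.mem_union, Finset.mem_filter, Finset.mem_univ, true_and] at hy ⊢
  by_cases hc : (G k j y).card < (Ls j).idxOf y + 1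
  · exact .inr ⟨hkj, hy.1, hy.2, hc⟩
  · exact .inl ⟨hy, by omega⟩

-- Split the items in front of `x` by owner. Those owned by `k` are in front of `x` in its private
-- list too, so they need no charge.
open Classical in
theorem Charging.idxOf_le (h : Charging L owner Ls G) (x : α) (k : Fin p) :
    L.idxOf x ≤ p * (Ls k).idxOf x +
      ∑ j, (Finset.univ.filter fun y => IsCharged L owner Ls G x k j y).card := by
  rw [← h.listing.card_filter_idxOf_lt x,
    Finset.card_eq_sum_card_fiberwise (f := owner) (t := Finset.univ) (by simp)]
  have : p * (Ls k).idxOf x = ∑ _j : Fin p, (Ls k).idxOf x := by simp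
  rw [this, ← Finset.sum_add_distrib]
  refine Finset.sum_le_sum fun j _ => ?_
  rw [Finset.filter_filter]
  rcases eq_or_ne k j with rfl | hkj
  · refine le_add_right ?_
    rw [← (h.listings k).card_filter_idxOf_lt x]
    refine Finset.card_le_card fun y hy => ?_
    simp only [Finset.mem_filter, Finset.mem_univ, true_and] at hy ⊢
    obtain ⟨hlt, rfl⟩ := hy
    exact h.owner_lt y x hlt
  · simpa only [and_comm] using h.card_owned_le x hkj

-- Conservation of charges: new ones are added, and those attached to requests for `x` by processes
-- in `S` are paid.
open Classical in
theorem Charging.chargeSum_next (h : Charging L owner Ls G) (x : α) (S : Finset (Fin p)) :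
    chargeSum G + ∑ k ∈ S, ∑ j,
        (Finset.univ.filter fun y => IsCharged L owner Ls G x k j y).card ≤
      chargeSum (chargeNext L owner Ls G x S) + ∑ j ∈ S, ∑ k, (G k j x).card := by
  have h1 : ∑ k ∈ S, ∑ j, (Finset.univ.filter fun y => IsCharged L owner Ls G x k j y).card =
      ∑ k, ∑ j, ∑ y, if k ∈ S ∧ IsCharged L owner Ls G x k j y then 1 else 0 := by
    rw [← Finset.univ_inter S, ← Finset.sum_ite_mem]
    refine Finset.sum_congr (by simp) fun k _ => ?_
    by_cases hk : k ∈ S <;> simp [hk]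
  have h2 : ∑ j ∈ S, ∑ k, (G k j x).card =
      ∑ k, ∑ j, ∑ y, if y = x ∧ j ∈ S then (G k j y).card else 0 := by
    rw [Finset.sum_comm, ← Finset.univ_inter S]
    refine Finset.sum_congr rfl fun k _ => ?_
    rw [← Finset.sum_ite_mem]
    refine Finset.sum_congr rfl fun j _ => ?_
    by_cases hj : j ∈ S <;> simp [hj]
  rw [h1, h2, chargeSum, chargeSum]
  simp only [← Finset.sum_add_distrib]
  refine Finset.sum_le_sum fun k _ => Finset.sum_le_sum fun j _ => Finset.sum_le_sum fun y _ => ?_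
  unfold chargeNext
  by_cases hy : y = x
  · subst hy
    have : ¬(k ∈ S ∧ IsCharged L owner Ls G y k j y) := fun hc => lt_irrefl _ hc.2.2.2.1
    rw [if_neg this]
    by_cases hj : j ∈ S <;> simp [hj]
  · simp only [hy, if_false, false_and]
    split_ifs with hc
    · have hx : x ∉ G k j y := fun hx => by
        obtain ⟨_, _, rfl, hlt, _⟩ := hc
        exact lt_irrefl _ (h.charged_lt k y x hlt x hx)
      rw [Finset.card_insert_of_notMem hx, add_zero]
    · exact le_rfl

/-- The items found by the processes in `S` are accounted for by the costs on their private lists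
and by new charges. -/
theorem Charging.accounting (h : Charging L owner Ls G) (x : α) (S : Finset (Fin p)) :
    S.card * (L.idxOf x + 1) + chargeSum G ≤
      (2 * p - 1) * ∑ k ∈ S, ((Ls k).idxOf x + 1) +
        chargeSum (chargeNext L owner Ls G x S) := by
  classical
  have h1 := h.chargeSum_next x S
  -- No process charges itself, hence `p - 1` rather than `p`.
  have h2 : ∑ j ∈ S, ∑ k, (G k j x).card ≤ ∑ j ∈ S, (p - 1) * ((Ls j).idxOf x + 1) := by
    refine Finset.sum_le_sum fun j _ => ?_
    rw [← Finset.add_sum_erase _ _ (Finset.mem_univ j), h.self_eq_empty, Finset.card_empty,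
      zero_add]
    refine (Finset.sum_le_card_nsmul _ _ _ fun k _ => h.card_le k j x).trans ?_
    simp
  have h3 : ∑ _k ∈ S, (L.idxOf x + 1) ≤ ∑ k ∈ S, (p * ((Ls k).idxOf x + 1) +
      ∑ j, (Finset.univ.filter fun y => IsCharged L owner Ls G x k j y).card) := by
    refine Finset.sum_le_sum fun k _ => ?_
    have := h.idxOf_le x k
    have hp : 0 < p := k.pos
    rw [mul_add]
    omega
  rw [Finset.sum_const, smul_eq_mul, Finset.sum_add_distrib, ← Finset.mul_sum] at h3
  rw [← Finset.mul_sum] at h2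
  have h4 : (2 * p - 1) * ∑ k ∈ S, ((Ls k).idxOf x + 1) =
      p * ∑ k ∈ S, ((Ls k).idxOf x + 1) + (p - 1) * ∑ k ∈ S, ((Ls k).idxOf x + 1) := by
    rw [← add_mul]
    congr 1
    omega
  omega

/-! ### Sequential Move-to-Front against an offline service of a longer sequence -/

/-- The pairs ordered differently by the two lists. -/
def inversions (L L' : List α) : Finset (α × α) :=
  Finset.univ.filter fun q => L.idxOf q.1 < L.idxOf q.2 ∧ L'.idxOf q.2 < L'.idxOf q.1

/-- Sequential Move-to-Front on a subsequence `J` of `I` costs at most twice as much as any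
offline service of `I`, up to the number of inversions of the two lists. -/
theorem OfflineCost.mtfCost_le {L' I : List α} {c : ℕ} (hc : OfflineCost L' I c) :
    IsListing L' → ∀ (L J : List α), IsListing L → J.Sublist I →
      mtfCost L J ≤ 2 * c + (inversions L L').card := by
  induction hc with
  | done L' =>
    intro _ L J _ hJ
    rw [List.sublist_nil.1 hJ]
    simp [mtfCost]
  | exchange u v x y I c hc ih =>
    intro hL' L J hL hJ
    have hp : (u ++ x :: y :: v).Perm (u ++ y :: x :: v) :=
      List.Perm.append_left u (List.Perm.swap _ _ _)
    have := ih (hL'.perm hp) L J hL hJ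
    have hsub : inversions L (u ++ y :: x :: v) ⊆
        insert (x, y) (inversions L (u ++ x :: y :: v)) := by
      intro ⟨b, d⟩ hq
      simp only [inversions, Finset.mem_filter, Finset.mem_univ, true_and, Finset.mem_insert,
        Prod.mk.injEq] at hq ⊢
      by_cases hxy : b = x ∧ d = y
      · exact .inl hxy
      · exact .inr ⟨hq.1, idxOf_lt_idxOf_of_swap hL'.1 (by tauto) hq.2⟩
    have hcard := (Finset.card_le_card hsub).trans (Finset.card_insert_le _ _)
    omega
  | access u v w a I c hc ih =>
    intro hL' L J hL hJ
    have hp : (u ++ v ++ a :: w).Perm (u ++ a :: (v ++ w)) := by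
      rw [List.append_assoc]
      exact List.Perm.append_left u List.perm_middle
    have hL'' := hL'.perm hp
    have hn := (hL'.card_filter_idxOf_lt a).trans (idxOf_append_cons_self hL'.1)
    have hfwd : ∀ {b d : α}, b ≠ a →
        (u ++ a :: (v ++ w)).idxOf b < (u ++ a :: (v ++ w)).idxOf d →
        (u ++ v ++ a :: w).idxOf b < (u ++ v ++ a :: w).idxOf d := fun hb h =>
      idxOf_lt_idxOf_of_forward hL'.1 (hL'.2 _) (hL'.2 _) hb h
    generalize u ++ v ++ a :: w = A at *
    generalize u ++ a :: (v ++ w) = B at *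
    generalize (u ++ v).length = n at *
    -- For a request missing from `J`, Move-to-Front does nothing; the offline move of `a` creates
    -- at most `n` inversions, which its access cost covers.
    have hskip : J.Sublist I → mtfCost L J ≤ 2 * (n + 1 + c) + (inversions L A).card := by
      intro hJ
      have := ih hL'' L J hL hJ
      have hsub : inversions L B ⊆ inversions L A ∪
          (Finset.univ.filter fun b => A.idxOf b < A.idxOf a).image fun b => (b, a) := by
        intro ⟨b, d⟩ hq
        simp only [inversions, Finset.mem_filter, Finset.mem_univ, true_and, Finset.mem_union,
          Finset.mem_image, Prod.mk.injEq] at hq ⊢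
        rcases eq_or_ne d a with rfl | hd
        · rcases lt_trichotomy (A.idxOf b) (A.idxOf d) with h | h | h
          · exact .inr ⟨b, h, rfl, rfl⟩
          · rw [hL'.idxOf_inj h] at hq
            exact absurd hq.1 (lt_irrefl _)
          · exact .inl ⟨hq.1, h⟩
        · exact .inl ⟨hq.1, hfwd hd hq.2⟩
      have h1 := Finset.card_le_card hsub
      have h2 := Finset.card_union_le (inversions L A)
        ((Finset.univ.filter fun b => A.idxOf b < A.idxOf a).image fun b => (b, a))
      have h3 : ((Finset.univ.filter fun b => A.idxOf b < A.idxOf a).image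
        fun b => (b, a)).card ≤ _ := Finset.card_image_le
      omega
    cases hJ with
    | cons _ hJ => exact hskip hJ
    | cons_cons _ hJ =>
      rename_i J
      have := ih hL'' (moveToFront a L) J (hL.moveToFront a) hJ
      have hidx := hL.card_filter_idxOf_lt a
      -- Items in front of `a` in `L` lie in `N` or `V`. The move in `L` destroys the inversions
      -- from `V`, and new ones come only from `N`; so cost plus potential change is at most `2 * n
      -- + 1`.
      set N := Finset.univ.filter fun b => A.idxOf b < A.idxOf a with hN
      set V := Finset.univ.filter fun b => L.idxOf b < L.idxOf a ∧ A.idxOf a < A.idxOf b with hV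
      have h1 : (Finset.univ.filter fun b => L.idxOf b < L.idxOf a) ⊆ V ∪ N := by
        intro b hb
        simp only [hV, hN, Finset.mem_filter, Finset.mem_univ, true_and, Finset.mem_union] at hb ⊢
        rcases lt_trichotomy (A.idxOf b) (A.idxOf a) with h | h | h
        · exact .inr h
        · rw [hL'.idxOf_inj h] at hb
          exact absurd hb (lt_irrefl _)
        · exact .inl ⟨hb, h⟩
      have h2 := (Finset.card_le_card h1).trans (Finset.card_union_le _ _)
      set R := (inversions L A).filter fun q => q.2 ≠ a with hR
      have h3 : inversions (moveToFront a L) B ⊆ R ∪ N.image fun b => (a, b) := by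
        intro ⟨b, d⟩ hq
        simp only [hR, hN, inversions, Finset.mem_filter, Finset.mem_univ, true_and,
          Finset.mem_union, Finset.mem_image, Prod.mk.injEq] at hq ⊢
        rcases eq_or_ne d a with rfl | hd
        · rw [idxOf_moveToFront_self] at hq
          exact absurd hq.1 (Nat.not_lt_zero _)
        · rcases eq_or_ne b a with rfl | hb
          · exact .inr ⟨d, hfwd hd hq.2, rfl, rfl⟩
          · refine .inl ⟨⟨?_, hfwd hd hq.2⟩, hd⟩
            have := hq.1
            rw [idxOf_moveToFront_of_ne hb _ (hL.2 a), idxOf_moveToFront_of_ne hd _ (hL.2 a)]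
              at this
            have hne : L.idxOf b ≠ L.idxOf d := fun e => by
              rw [hL.idxOf_inj e] at hq
              exact lt_irrefl _ hq.1
            split_ifs at this <;> omega
      have h4 := (Finset.card_le_card h3).trans (Finset.card_union_le _ _)
      have h5 : (N.image fun b => (a, b)).card ≤ N.card := Finset.card_image_le
      have h6 : R ∪ V.image (fun b => (b, a)) ⊆ inversions L A := by
        intro ⟨b, d⟩ hq
        simp only [hR, hV, inversions, Finset.mem_filter, Finset.mem_univ, true_and,
          Finset.mem_union, Finset.mem_image, Prod.mk.injEq] at hq ⊢
        rcases hq with hq | ⟨_, hq, rfl, rfl⟩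
        exacts [hq.1, hq]
      have h7 : Disjoint R (V.image fun b => (b, a)) := by
        rw [Finset.disjoint_left]
        intro ⟨b, d⟩ hq hq'
        obtain ⟨_, _, e⟩ := Finset.mem_image.1 hq'
        exact (Finset.mem_filter.1 hq).2 (Prod.ext_iff.1 e).2.symm
      have h8 := Finset.card_le_card h6
      rw [Finset.card_union_of_disjoint h7, Finset.card_image_of_injective _
        (fun b d e => (Prod.ext_iff.1 e).1)] at h8
      rw [mtfCost]
      omega

theorem mtfCost_le_two_mul_opt {L I J : List α} (hL : IsListing L) (hJ : J.Sublist I) :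
    mtfCost L J ≤ 2 * opt L I := by
  have := OfflineCost.mtfCost_le (Nat.sInf_mem (exists_offlineCost L I fun a _ => hL.2 a)) hL L J
    hL hJ
  have h0 : inversions L L = ∅ := by
    refine Finset.filter_eq_empty_iff.2 fun q _ h => lt_asymm h.1 h.2
  rw [h0, Finset.card_empty, add_zero] at this
  exact this

/-! ### The execution of distributed Move-to-Front -/

/-- The requests of a process whose items have not yet been found, by itself or, during its search,
by another process. -/
def Searcher.unfound (P : Searcher α) : List α :=
  match P.foundAt with
  | none => P.pending
  | some _ => P.pending.tail

/-- The invariant of an execution of distributed Move-to-Front: the cost so far, the work that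
processes are going to do for items already found, and the future cost of the processes on their
private lists are bounded by the cost of sequential Move-to-Front on the separate request
sequences and by work on items not yet found, up to the charges. -/
structure Bounded (A : ℕ) (C : Config p α) (owner : α → Fin p) (Ls : Fin p → List α)
    (G : Fin p → Fin p → α → Finset α) : Prop where
  charging : Charging C.list owner Ls G
  inspected_eq_zero : ∀ i, (C.procs i).pending = [] → (C.procs i).inspected = 0
  cost_le : C.cost + ∑ i, (C.procs i).foundAt.getD 0 +
      (2 * p - 1) * ∑ i, mtfCost (Ls i) (C.procs i).unfound ≤
    A + ∑ i, (C.procs i).inspected + chargeSum G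

variable {A : ℕ} {C : Config p α} {owner : α → Fin p} {Ls : Fin p → List α}
  {G : Fin p → Fin p → α → Finset α}

/-- Changing the state of one process, with its unfound requests unchanged. -/
theorem Bounded.update (h : Bounded A C owner Ls G) (i : Fin p) (P : Searcher α)
    (M : List (Fin p × α)) (hu : P.unfound = (C.procs i).unfound)
    (h0 : P.pending = [] → P.inspected = 0)
    (hc : P.foundAt.getD 0 + 1 + (C.procs i).inspected =
      (C.procs i).foundAt.getD 0 + P.inspected) :
    Bounded A ⟨C.list, Function.update C.procs i P, M, C.cost + 1⟩ owner Ls G where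
  charging := h.charging
  inspected_eq_zero j hj := by
    rcases eq_or_ne j i with rfl | hji
    · simpa using h0 (by simpa using hj)
    · simp only [Function.update_of_ne hji] at hj ⊢
      exact h.inspected_eq_zero j hj
  cost_le := by
    have := h.cost_le
    have e1 : ∑ j, mtfCost (Ls j) (Function.update C.procs i P j).unfound =
        ∑ j, mtfCost (Ls j) (C.procs j).unfound := by
      refine Finset.sum_congr rfl fun j _ => ?_
      rcases eq_or_ne j i with rfl | hji
      · rw [Function.update_self, hu]
      · rw [Function.update_of_ne hji]
    have e2 : ∀ f : Searcher α → ℕ, ∑ j, f (Function.update C.procs i P j) + f (C.procs i) =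
        ∑ j, f (C.procs j) + f P := fun f => by
      rw [← Finset.sum_erase_add _ _ (Finset.mem_univ i),
        ← Finset.sum_erase_add _ (fun j => f (C.procs j)) (Finset.mem_univ i),
        Function.update_self, Finset.sum_congr rfl fun j hj => by
          rw [Function.update_of_ne (Finset.ne_of_mem_erase hj)]]
      omega
    have e3 := e2 fun P => P.foundAt.getD 0
    have e4 := e2 fun P => P.inspected
    simp only [e1]
    omega

/-- A process finds its item and moves it to the front. -/
theorem Bounded.found (h : Bounded A C owner Ls G) (i : Fin p) {a : α} {rest : List α}
    (M : List (Fin p × α)) (hpend : (C.procs i).pending = a :: rest)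
    (hfound : (C.procs i).foundAt = none) (hidx : C.list.idxOf a = (C.procs i).inspected) :
    ∃ owner' Ls' G', Bounded A ⟨moveToFront a C.list,
      Function.update (fun j => (C.procs j).notify a ((C.procs i).inspected + 1)) i ⟨rest, 0, none⟩,
      M, C.cost + 1⟩ owner' Ls' G' := by
  -- `S` consists of the finder and the processes it notifies: exactly those whose private lists
  -- move `a` now.
  classical
  set n := (C.procs i).inspected with hn
  set S : Finset (Fin p) := Finset.univ.filter fun j => j = i ∨
    ((C.procs j).pending.head? = some a ∧ 0 < (C.procs j).inspected ∧
      (C.procs j).foundAt = none) with hS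
  have hi : i ∈ S := by simp [hS]
  refine ⟨_, _, _, h.charging.next a hi, ?_, ?_⟩
  · intro j hj
    rcases eq_or_ne j i with rfl | hji
    · simp
    · simp only [Function.update_of_ne hji, Searcher.notify] at hj ⊢
      have := h.inspected_eq_zero j
      split_ifs at hj ⊢ <;> exact this hj
  · have hacc := h.charging.accounting a S
    have hcost := h.cost_le
    set procs' := Function.update (fun j => (C.procs j).notify a (n + 1)) i ⟨rest, 0, none⟩
      with hprocs'
    have e1 : ∑ j, mtfCost (Ls j) (C.procs j).unfound =
        ∑ j, mtfCost (if j ∈ S then moveToFront a (Ls j) else Ls j) (procs' j).unfound +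
          ∑ j ∈ S, ((Ls j).idxOf a + 1) := by
      rw [← Finset.univ_inter S, ← Finset.sum_ite_mem, Finset.univ_inter, ← Finset.sum_add_distrib]
      refine Finset.sum_congr rfl fun j _ => ?_
      rcases eq_or_ne j i with rfl | hji
      · simp [hprocs', hi, Searcher.unfound, hfound, hpend, mtfCost, add_comm]
      · by_cases hj : j ∈ S
        · have hcond := ((Finset.mem_filter.1 hj).2).resolve_left hji
          obtain ⟨t, ht⟩ : ∃ t, (C.procs j).pending = a :: t := by
            cases hq : (C.procs j).pending with
            | nil => simp [hq] at hcond
            | cons b t => exact ⟨t, by simpa [hq] using hcond.1⟩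
          simp only [hprocs', Function.update_of_ne hji, Searcher.notify, if_pos hcond, if_pos hj]
          simp [Searcher.unfound, hcond.2.2, ht, mtfCost, add_comm]
        · have hcond : ¬((C.procs j).pending.head? = some a ∧ 0 < (C.procs j).inspected ∧
              (C.procs j).foundAt = none) := fun hc =>
            hj (Finset.mem_filter.2 ⟨Finset.mem_univ _, .inr hc⟩)
          simp only [hprocs', Function.update_of_ne hji, Searcher.notify, if_neg hcond, if_neg hj,
            add_zero]
    -- The finder belongs to `S` but is not notified; the extra `n + 1` on the left stands for its
    -- own search, which is complete.
    have e2 : ∑ j, (procs' j).foundAt.getD 0 + (n + 1) =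
        ∑ j, (C.procs j).foundAt.getD 0 + S.card * (n + 1) := by
      have : n + 1 = ∑ j : Fin p, if j = i then n + 1 else 0 := by simp
      conv_lhs => rw [this]
      have : S.card * (n + 1) = ∑ j, if j ∈ S then n + 1 else 0 := by simp
      rw [this, ← Finset.sum_add_distrib, ← Finset.sum_add_distrib]
      refine Finset.sum_congr rfl fun j _ => ?_
      rcases eq_or_ne j i with rfl | hji
      · simp [hprocs', hi, hfound]
      · by_cases hj : j ∈ S
        · have hcond := ((Finset.mem_filter.1 hj).2).resolve_left hji
          simp only [hprocs', Function.update_of_ne hji, Searcher.notify, if_pos hcond, if_pos hj]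
          simp [hcond.2.2, hji]
        · have hcond : ¬((C.procs j).pending.head? = some a ∧ 0 < (C.procs j).inspected ∧
              (C.procs j).foundAt = none) := fun hc =>
            hj (Finset.mem_filter.2 ⟨Finset.mem_univ _, .inr hc⟩)
          simp only [hprocs', Function.update_of_ne hji, Searcher.notify, if_neg hcond, if_neg hj,
            if_neg hji]
    have e3 : ∑ j, (procs' j).inspected + n = ∑ j, (C.procs j).inspected := by
      have : n = ∑ j : Fin p, if j = i then n else 0 := by simp
      conv_lhs => rw [this]
      rw [← Finset.sum_add_distrib]
      refine Finset.sum_congr rfl fun j _ => ?_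
      rcases eq_or_ne j i with rfl | hji
      · simp [hprocs', hn]
      · simp only [hprocs', Function.update_of_ne hji, Searcher.notify, if_neg hji, add_zero]
        split_ifs <;> rfl
    rw [e1, mul_add] at hcost
    rw [hidx] at hacc
    simp only
    omega

theorem Bounded.step (h : Bounded A C owner Ls G) (i : Fin p) :
    ∃ owner' Ls' G', Bounded A (step C i) owner' Ls' G' := by
  unfold ListAccess.step
  split
  · exact ⟨_, _, _, h⟩
  · rename_i a rest hpend
    dsimp only
    have hgo : Bounded A
        { C with
          procs := Function.update C.procs i
            { C.procs i with inspected := (C.procs i).inspected + 1 }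
          cost := C.cost + 1 } owner Ls G :=
      h.update i _ _ rfl (by simp [hpend]) (by dsimp only; omega)
    split
    · rename_i hfound
      split_ifs with hget
      · refine h.found i _ hpend hfound ?_
        obtain ⟨hlt, rfl⟩ := List.getElem?_eq_some_iff.1 hget
        exact h.charging.listing.1.idxOf_getElem _ hlt
      · exact ⟨_, _, _, hgo⟩
    · rename_i k hfound
      split_ifs with hk
      · refine ⟨_, _, _, h.update i _ _ ?_ (fun _ => rfl) ?_⟩
        · simp [Searcher.unfound, hfound, hpend]
        · simp only [hfound, Option.getD_none, Option.getD_some]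
          omega
      · exact ⟨_, _, _, hgo⟩

theorem Bounded.foldl (s : List (Fin p)) (h : Bounded A C owner Ls G) :
    ∃ owner' Ls' G', Bounded A (s.foldl ListAccess.step C) owner' Ls' G' := by
  induction s generalizing C owner Ls G with
  | nil => exact ⟨_, _, _, h⟩
  | cons i s ih =>
    obtain ⟨_, _, _, h'⟩ := h.step i
    exact ih h'

/-- The cost of distributed Move-to-Front is bounded by the costs of sequential Move-to-Front on
the separate request sequences. -/
theorem dmtfCost_le {L : List α} (hL : IsListing L) (σ : Fin p → List α) (s : List (Fin p))
    (hdone : ∀ i, ((dmtf L σ s).procs i).pending = []) (i₀ : Fin p) :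
    dmtfCost L σ s ≤ (2 * p - 1) * ∑ i, mtfCost L (σ i) +
      p * (p * (Fintype.card α * Fintype.card α)) := by
  have hinit : Bounded ((2 * p - 1) * ∑ i, mtfCost L (σ i)) (Config.init L σ) (fun _ => i₀)
      (fun _ => L) (fun _ _ _ => ∅) :=
    ⟨charging_init L hL i₀, fun _ _ => rfl, by simp [Config.init, Searcher.unfound]⟩
  obtain ⟨_, _, G, h⟩ := hinit.foldl s
  -- At the end no search is open, so only unpaid charges remain beside the private costs.
  have hins : ∑ i, ((dmtf L σ s).procs i).inspected = 0 :=
    Finset.sum_eq_zero fun i _ => h.inspected_eq_zero i (hdone i)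
  have h1 := h.cost_le
  have h2 := chargeSum_le G
  unfold dmtfCost
  unfold dmtf at hins ⊢
  omega

end ListAccess

/-! ### Combining the two comparisons -/

theorem mainTheorem4 (p ℓ : ℕ) :
    ∃ K : ℝ, ∀ (L₀ : List (Fin ℓ)), L₀.Perm (List.finRange ℓ) →
      ∀ (σ : Fin p → List (Fin ℓ)) (M₁ M₂ : List (Fin p × Fin ℓ)),
        ListAccess.IsMerge σ M₁ → ListAccess.IsMerge σ M₂ →
          ∀ s : List (Fin p), ListAccess.DMTFServes L₀ σ s M₁ →
            (ListAccess.dmtfCost L₀ σ s : ℝ) ≤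
              (4 * (p : ℝ) ^ 2 - 2 * (p : ℝ)) *
                (ListAccess.opt L₀ (M₂.map Prod.snd) : ℝ) + K := by
  refine ⟨(p * (p * (ℓ * ℓ)) : ℕ), fun L₀ hL₀ σ M₁ M₂ _ hM₂ s hs => ?_⟩
  have hL : ListAccess.IsListing L₀ :=
    ⟨hL₀.nodup_iff.2 (List.nodup_finRange ℓ), fun a => hL₀.mem_iff.2 (List.mem_finRange a)⟩
  -- Without processes there is no initial owner to choose, and `2 * p - 1` would be truncated.
  rcases Nat.eq_zero_or_pos p with rfl | hp
  · obtain rfl : s = [] := by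
      cases s with
      | nil => rfl
      | cons i _ => exact i.elim0
    simp [ListAccess.dmtfCost, ListAccess.dmtf, ListAccess.Config.init]
  · have h1 := ListAccess.dmtfCost_le hL σ s hs.1 ⟨0, hp⟩
    have h2 : ∑ i, ListAccess.mtfCost L₀ (σ i) ≤
        ∑ _i : Fin p, 2 * ListAccess.opt L₀ (M₂.map Prod.snd) :=
      Finset.sum_le_sum fun i _ => ListAccess.mtfCost_le_two_mul_opt hL <| by
        rw [← hM₂ i]
        exact List.filter_sublist.map _
    rw [Finset.sum_const, Finset.card_univ, Fintype.card_fin, smul_eq_mul] at h2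
    rw [Fintype.card_fin] at h1
    have h3 := h1.trans (Nat.add_le_add_right (Nat.mul_le_mul_left (2 * p - 1) h2) _)
    have h4 : (((2 * p - 1 : ℕ)) : ℝ) = 2 * p - 1 := by
      rw [Nat.cast_sub (by omega)]
      push_cast
      ring
    have h5 : (ListAccess.dmtfCost L₀ σ s : ℝ) ≤ _ := Nat.cast_le.2 h3
    rw [Nat.cast_add, Nat.cast_mul, h4] at h5
    refine h5.trans (le_of_eq ?_)
    push_cast
    ring
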